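/- Let $n$ be a positive integer and let $S_n$ be the set of permutations of $\{1,\dots,n\}$ with the metric $d(f,g)=\max_{1\le i\le n}|f(i)-g(i)|$. For an integer $r$, the size of the ball $\{g\in S_n : d(f,g)\le r\}$ does not depend on its center $f\in S_n$; denote this size by $|B_{r,n}|$. Let $r$ be an integer with $\frac{n-1}{2}<r<n-1$. Then the equation $$\alpha^{n-r}+(2r-n)\,\alpha-(2r-n+2)=0$$ has exactly one positive real solution $\alpha=\alpha_{r,n}$, and $$\log_2|B_{r,n}|\;\ge\;\log_2(n!)-n\log_2 n-n\log_2(\alpha_{r,n}-1)+(n-r)(2r-n+2)\log_2\alpha_{r,n}.$$ -/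

import Mathlib

/-- The infinity distance `max_i |f(i) - g(i)|` between two permutations of an `n`-element
initial segment of the integers (here `{0, …, n-1}`; shifting to `{1, …, n}` changes nothing). -/
def permInfDist {n : ℕ} (f g : Equiv.Perm (Fin n)) : ℕ :=
  Finset.univ.sup fun i : Fin n => (((f i : ℕ) : ℤ) - ((g i : ℕ) : ℤ)).natAbs

/-- The ball of radius `r` around `f` in the symmetric group with the infinity distance. -/
def permBall (r n : ℕ) (f : Equiv.Perm (Fin n)) : Finset (Equiv.Perm (Fin n)) :=
  Finset.univ.filter fun g => permInfDist f g ≤ r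

/-- `α` is a positive root of `α ^ (n - r) + (2 r - n) α - (2 r - n + 2) = 0`.
The exponent is a subtraction of natural numbers, used only for `r ≤ n`; the coefficients
are real numbers. -/
def IsAlpha (r n : ℕ) (α : ℝ) : Prop :=
  0 < α ∧
    α ^ (n - r) + (2 * (r : ℝ) - (n : ℝ)) * α - (2 * (r : ℝ) - (n : ℝ) + 2) = 0

/-!
The ball around `f` is counted by the permanent of a `0/1` matrix: up to a permutation of one index,
the band matrix `A` with `A i j = 1` exactly when `|i - j| ≤ r`. The lower bound is van der Waerden's
inequality applied to a doubly stochastic matrix obtained from `A` by scaling rows and columns.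

*Scaling.* Put `p + 1 = n - r` and `m = 2 r - n`, and let `bandExponent r p i` be the number of
zeros in row `i` of `A`. If `α ^ (p + 1) + m α = m + 2`, the sums of `α ^ bandExponent r p j` over
intervals of columns telescope, and the matrix with entries
`(α - 1) / α ^ (p + 1) * A i j * α ^ (bandExponent r p i + bandExponent r p j)` is symmetric with
row sums `1` (`sum_scale_row`). The exponents add up to `p (p + 1)` (`sum_bandExponent`), so its
permanent is `((α - 1) / α ^ (p + 1)) ^ n * α ^ (2 p (p + 1))` times the size of the ball; taking
logarithms gives the theorem.

*Van der Waerden's inequality* (`Matrix.vanDerWaerden`) is proved by Gurvits' capacity method. For a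
positive matrix with columns `a j`, consider the forms
`mixedPermanent (y, …, y, a m, …, a (n - 1))` in `y = ∑ j < m, x j • a j`, with `y` repeated `m`
times. For `m = n` the form is `n!` times the product of the linear forms `(M *ᵥ x) i`, which for
doubly stochastic `M` is at least `n! ∏ x j` by the weighted inequality of arithmetic and geometric
means; for `m = 1` and `x = 1` it is the permanent. To pass from `m + 1` to `m`, restrict the form to the line `y + t • a m`.
The resulting polynomial in `t` has only real negative roots (`mixedPermanent.root_linePoly_neg`),
which follows from stability, that is, nonvanishing on the right half plane, and stability is
inherited by the next form by the Gauss–Lucas theorem (`mixedPermanent.ne_zero_of_re_pos`). Hence the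
polynomial is bounded by a power of an affine function with the same value and derivative at `0`,
and the best choice of `t` bounds that derivative, which is the next form, from below
(`mixedPermanent.capacity_step`). General doubly stochastic matrices follow by continuity.
-/

/-! ### Mixed permanents -/

/-- The sum, over all injective choices of one index in `S` for each vector of the list `l`,
of the products of the chosen coordinates. If `l` has as many vectors as `S` has elements, this
is the permanent of the matrix whose columns are the vectors of `l`. Working with lists lets one
repeat a vector, and deleting an index from `S` gives the minors of the expansion along a column. -/
def mixedPermanent {ι R : Type*} [DecidableEq ι] [CommSemiring R] :
    List (ι → R) → Finset ι → R
  | [], _ => 1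
  | v :: l, S => ∑ i ∈ S, v i * mixedPermanent l (S.erase i)

namespace mixedPermanent

open Polynomial

section Semiring

variable {ι R : Type*} [DecidableEq ι] [CommSemiring R]

@[simp] lemma nil (S : Finset ι) : mixedPermanent ([] : List (ι → R)) S = 1 := rfl

lemma cons (v : ι → R) (l : List (ι → R)) (S : Finset ι) :
    mixedPermanent (v :: l) S = ∑ i ∈ S, v i * mixedPermanent l (S.erase i) := rfl

lemma swap (u v : ι → R) (l : List (ι → R)) (S : Finset ι) :
    mixedPermanent (u :: v :: l) S = mixedPermanent (v :: u :: l) S := by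
  simp only [cons, Finset.mul_sum]
  rw [Finset.sum_comm' (t' := S) (s' := fun j => S.erase j)]
  · refine Finset.sum_congr rfl fun j _ => Finset.sum_congr rfl fun i _ => ?_
    rw [Finset.erase_right_comm]
    ring
  · intro i j
    simp only [Finset.mem_erase]
    tauto

lemma perm {l l' : List (ι → R)} (h : l.Perm l') (S : Finset ι) :
    mixedPermanent l S = mixedPermanent l' S := by
  induction h generalizing S with
  | nil => rfl
  | cons v _ ih => simp only [cons, ih]
  | swap u v l => exact swap v u l S
  | trans _ _ ih₁ ih₂ => exact (ih₁ S).trans (ih₂ S)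

lemma replicate_card (y : ι → R) (m : ℕ) (S : Finset ι) (h : S.card = m) :
    mixedPermanent (List.replicate m y) S = m.factorial * ∏ i ∈ S, y i := by
  induction m generalizing S with
  | zero => simp [Finset.card_eq_zero.mp h]
  | succ m ih =>
    rw [List.replicate_succ, cons]
    have : ∀ i ∈ S, y i * mixedPermanent (List.replicate m y) (S.erase i)
        = m.factorial * ∏ i ∈ S, y i := by
      intro i hi
      rw [ih _ (by rw [Finset.card_erase_of_mem hi, h]; rfl), ← Finset.mul_prod_erase S y hi]
      ring
    rw [Finset.sum_congr rfl this, Finset.sum_const, h, Nat.factorial_succ]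
    simp [nsmul_eq_mul, mul_assoc]

lemma map {R' : Type*} [CommSemiring R'] (φ : R →+* R') (l : List (ι → R)) (S : Finset ι) :
    mixedPermanent (l.map fun v i => φ (v i)) S = φ (mixedPermanent l S) := by
  induction l generalizing S with
  | nil => simp
  | cons v l ih => simp [cons, ih]

lemma replicate_smul_append (c : R) (z : ι → R) (m : ℕ) (l : List (ι → R)) (S : Finset ι) :
    mixedPermanent (List.replicate m (c • z) ++ l) S
      = c ^ m * mixedPermanent (List.replicate m z ++ l) S := by
  induction m generalizing S with
  | zero => simp
  | succ m ih =>
    simp only [List.replicate_succ, List.cons_append, cons, ih, Finset.mul_sum]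
    refine Finset.sum_congr rfl fun i _ => ?_
    simp only [Pi.smul_apply, smul_eq_mul]
    ring

/-- For a list of `k` vectors in the coordinates `S`, the mixed permanent is the sum over the
injections of the `k` positions into `S`. -/
lemma ofFn {k : ℕ} [Fintype ι] (a : Fin k → ι → R) (S : Finset ι) :
    mixedPermanent (List.ofFn a) S
      = ∑ f : Fin k → ι, if Function.Injective f ∧ ∀ j, f j ∈ S then ∏ j, a j (f j) else 0 := by
  induction k generalizing S with
  | zero => simp [Function.injective_of_subsingleton]
  | succ k ih =>
    rw [List.ofFn_succ, cons, ← (Fin.consEquiv fun _ => ι).sum_comp, Fintype.sum_prod_type,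
      ← Finset.sum_subset (Finset.subset_univ S)]
    · refine Finset.sum_congr rfl fun i hi => ?_
      rw [ih, Finset.mul_sum]
      refine Finset.sum_congr rfl fun g _ => ?_
      have : (Function.Injective (Fin.cons i g : Fin (k + 1) → ι) ∧
            ∀ j, (Fin.cons i g : Fin (k + 1) → ι) j ∈ S)
          ↔ Function.Injective g ∧ ∀ j, g j ∈ S.erase i := by
        simp only [Fin.cons_injective_iff, Fin.forall_fin_succ, Fin.cons_zero, Fin.cons_succ,
          Finset.mem_erase, Set.mem_range, not_exists, forall_and, ne_eq]
        tauto
      have e : (Fin.consEquiv fun _ => ι) (i, g) = (Fin.cons i g : Fin (k + 1) → ι) := rfl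
      rw [e]
      simp only [this, mul_ite, mul_zero, Fin.prod_univ_succ, Fin.cons_zero, Fin.cons_succ]
    · intro i _ hi
      refine Finset.sum_eq_zero fun g _ => if_neg fun h => hi ?_
      simpa using h.2 0

lemma ofFn_univ {n : ℕ} (M : Matrix (Fin n) (Fin n) R) :
    mixedPermanent (List.ofFn fun j i => M i j) Finset.univ = M.permanent := by
  rw [ofFn, Matrix.permanent, ← Finset.sum_filter]
  symm
  refine Finset.sum_bij (fun σ _ => (σ : Fin n → Fin n)) ?_ ?_ ?_ ?_
  · intro σ _
    simpa using σ.injective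
  · intro σ _ τ _ h
    exact Equiv.ext (congrFun h)
  · intro f hf
    simp only [Finset.mem_univ, implies_true, and_true, Finset.mem_filter, true_and] at hf
    exact ⟨Equiv.ofBijective f (Finite.injective_iff_bijective.mp hf), Finset.mem_univ _, rfl⟩
  · intro σ _
    rfl

end Semiring

lemma pos {ι : Type*} [DecidableEq ι] (l : List (ι → ℝ)) (S : Finset ι)
    (hl : ∀ v ∈ l, ∀ i, 0 < v i) (h : l.length ≤ S.card) : 0 < mixedPermanent l S := by
  induction l generalizing S with
  | nil => simp
  | cons v l ih =>
    rw [cons]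
    rw [List.length_cons] at h
    refine Finset.sum_pos (fun i hi => mul_pos (hl v (by simp) i) (ih _ ?_ ?_)) ?_
    · exact fun w hw => hl w (by simp [hw])
    · rw [Finset.card_erase_of_mem hi]; omega
    · exact Finset.card_pos.mp (by omega)

section Polynomial

variable {ι K : Type*} [DecidableEq ι] [CommRing K]

/-- The univariate polynomial obtained from the mixed permanent by repeating `m` times the
vector `y + X a`, the vectors of `l` being constant. -/
noncomputable def linePoly (m : ℕ) (y a : ι → K) (l : List (ι → K)) (S : Finset ι) : K[X] :=
  mixedPermanent (List.replicate m (fun i => C (y i) + X * C (a i)) ++ l.map fun v i => C (v i)) S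

lemma linePoly_succ (m : ℕ) (y a : ι → K) (l : List (ι → K)) (S : Finset ι) :
    linePoly (m + 1) y a l S
      = ∑ i ∈ S, (C (y i) + X * C (a i)) * linePoly m y a l (S.erase i) := rfl

lemma linePoly_zero (y a : ι → K) (l : List (ι → K)) (S : Finset ι) :
    linePoly 0 y a l S = C (mixedPermanent l S) := map C l S

lemma eval_linePoly (m : ℕ) (y a : ι → K) (l : List (ι → K)) (S : Finset ι) (t : K) :
    (linePoly m y a l S).eval t = mixedPermanent (List.replicate m (y + t • a) ++ l) S := by
  rw [linePoly, ← coe_evalRingHom, ← map]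
  congr 1
  simp [Function.comp_def, Pi.add_def, mul_comm (a _) t]

lemma map_linePoly {K' : Type*} [CommRing K'] (φ : K →+* K') (m : ℕ) (y a : ι → K)
    (l : List (ι → K)) (S : Finset ι) :
    (linePoly m y a l S).map φ
      = linePoly m (fun i => φ (y i)) (fun i => φ (a i)) (l.map fun v i => φ (v i)) S := by
  rw [linePoly, ← coe_mapRingHom, ← map, linePoly]
  congr 1
  simp only [List.map_append, List.map_replicate, List.map_map, Function.comp_def,
    coe_mapRingHom, Polynomial.map_add, Polynomial.map_mul, map_C, map_X]

lemma natDegree_linePoly_le (m : ℕ) (y a : ι → K) (l : List (ι → K)) (S : Finset ι) :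
    (linePoly m y a l S).natDegree ≤ m := by
  induction m generalizing S with
  | zero => simp [linePoly_zero]
  | succ m ih =>
    rw [linePoly_succ]
    refine natDegree_sum_le_of_forall_le _ _ fun i _ => ?_
    refine natDegree_mul_le.trans ?_
    have : (C (y i) + X * C (a i)).natDegree ≤ 1 := by compute_degree
    have := ih (S.erase i)
    omega

lemma coeff_linePoly (m : ℕ) (y a : ι → K) (l : List (ι → K)) (S : Finset ι) :
    (linePoly m y a l S).coeff m = mixedPermanent (List.replicate m a ++ l) S := by
  induction m generalizing S with
  | zero => simp [linePoly_zero]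
  | succ m ih =>
    rw [linePoly_succ, finsetSum_coeff, List.replicate_succ, List.cons_append, cons]
    refine Finset.sum_congr rfl fun i _ => ?_
    have h := natDegree_linePoly_le m y a l (S.erase i)
    rw [add_mul, coeff_add, coeff_C_mul, coeff_eq_zero_of_natDegree_lt (by omega), mul_assoc,
      coeff_X_mul, coeff_C_mul, ih]
    simp

/-- By symmetry all `m + 1` factors contribute equally to the derivative. -/
lemma derivative_linePoly (m : ℕ) (y a : ι → K) (l : List (ι → K)) (S : Finset ι) :
    derivative (linePoly (m + 1) y a l S) = (m + 1) * linePoly m y a (a :: l) S := by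
  induction m generalizing S with
  | zero => simp [linePoly_succ, linePoly_zero, cons]
  | succ m ih =>
    have key : linePoly (m + 1) y a (a :: l) S
        = ∑ i ∈ S, C (a i) * linePoly (m + 1) y a l (S.erase i) := by
      rw [linePoly, List.map_cons, perm List.perm_middle, cons]
      rfl
    rw [linePoly_succ (m + 1) y a l S, derivative_sum]
    simp only [derivative_mul, ih, derivative_add, derivative_C, derivative_X, zero_add, one_mul,
      mul_zero, add_zero, Finset.sum_add_distrib, ← key]
    have h2 := linePoly_succ m y a (a :: l) S
    simp only [mul_left_comm _ ((m : K[X]) + 1), ← Finset.mul_sum, ← h2]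
    push_cast
    ring

end Polynomial

end mixedPermanent

/-! ### Stability -/

namespace mixedPermanent

open Polynomial

variable {ι : Type*} [DecidableEq ι]

/-- If all roots of a complex polynomial lie in the open left half plane, its derivative does not
vanish at `0`, by the Gauss–Lucas theorem. -/
lemma eval_zero_derivative_ne_zero {p : ℂ[X]} (hp : derivative p ≠ 0)
    (h : ∀ w : ℂ, 0 ≤ w.re → p.eval w ≠ 0) : (derivative p).eval 0 ≠ 0 := by
  intro h0
  have hdeg : 0 < p.degree := by
    rw [← natDegree_pos_iff_degree_pos]
    by_contra hc
    rw [eq_C_of_natDegree_eq_zero (by omega : p.natDegree = 0)] at hp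
    simp at hp
  have hmem : (0 : ℂ) ∈ p.derivative.rootSet ℂ := by
    rw [mem_rootSet]
    exact ⟨hp, by simpa using h0⟩
  have hsub : p.rootSet ℂ ⊆ {w : ℂ | w.re < 0} := by
    intro w hw
    rw [mem_rootSet] at hw
    by_contra hc
    exact h w (not_lt.mp hc) (by simpa using hw.2)
  have := convexHull_min hsub (convex_halfSpace_re_lt 0)
    (rootSet_derivative_subset_convexHull_rootSet hdeg hmem)
  simp at this

/-- Stability: with positive vectors in the remaining positions, the mixed permanent does not vanish
when a vector of the open right half plane is repeated. Each vector of `l` is obtained by one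
differentiation in its direction, which preserves nonvanishing. -/
lemma ne_zero_of_re_pos (l : List (ι → ℝ)) (hl : ∀ v ∈ l, ∀ i, 0 < v i) (m : ℕ) (S : Finset ι)
    (hS : m + l.length = S.card) (z : ι → ℂ) (hz : ∀ i, 0 < (z i).re) :
    mixedPermanent (List.replicate m z ++ l.map fun v i => (v i : ℂ)) S ≠ 0 := by
  induction l generalizing m z with
  | nil =>
    rw [List.map_nil, List.append_nil, replicate_card z m S (by simpa using hS.symm)]
    refine mul_ne_zero (by exact_mod_cast m.factorial_ne_zero) (Finset.prod_ne_zero_iff.mpr ?_)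
    intro i _ h0
    have := hz i
    simp [h0] at this
  | cons b l ih =>
    have hb : ∀ i, 0 < b i := hl b (by simp)
    have hl' : ∀ v ∈ l, ∀ i, 0 < v i := fun v hv => hl v (by simp [hv])
    rw [List.length_cons] at hS
    set l' : List (ι → ℂ) := l.map fun v i => (v i : ℂ) with hl'_def
    set b' : ι → ℂ := fun i => (b i : ℂ) with hb'
    set p := linePoly (m + 1) z b' l' S with hp
    have hroots : ∀ w : ℂ, 0 ≤ w.re → p.eval w ≠ 0 := by
      intro w hw
      rw [hp, eval_linePoly]
      refine ih hl' (m + 1) (by omega) _ fun i => ?_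
      have : 0 ≤ w.re * b i := mul_nonneg hw (hb i).le
      simpa [hb'] using add_pos_of_pos_of_nonneg (hz i) this
    have hder : derivative p ≠ 0 := by
      intro h0
      have h1 : (derivative p).coeff m = 0 := by simp [h0]
      rw [coeff_derivative, hp, coeff_linePoly] at h1
      have h2 := ih hl' (m + 1) (by omega) b' (fun i => by simpa [hb'] using hb i)
      exact mul_ne_zero h2 (by exact_mod_cast m.succ_ne_zero) h1
    have h := eval_zero_derivative_ne_zero hder hroots
    rw [hp, derivative_linePoly, eval_mul, eval_linePoly] at h
    simpa using right_ne_zero_of_mul h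

/-- Along a positive direction through a positive point the mixed permanent has only real negative
roots: any other root could be rotated into the open right half plane. -/
lemma root_linePoly_neg (l : List (ι → ℝ)) (hl : ∀ v ∈ l, ∀ i, 0 < v i) (m : ℕ) (S : Finset ι)
    (hS : m + l.length = S.card) {y a : ι → ℝ} (hy : ∀ i, 0 < y i) (ha : ∀ i, 0 < a i) {w : ℂ}
    (hw : ((linePoly m y a l S).map Complex.ofRealHom).eval w = 0) : w.im = 0 ∧ w.re < 0 := by
  rw [map_linePoly, eval_linePoly] at hw
  have key : ∀ c : ℂ, ∃ i, (c * (y i + w * a i)).re ≤ 0 := by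
    intro c
    by_contra! hc
    refine ne_zero_of_re_pos l hl m S hS
      (c • ((fun i => Complex.ofRealHom (y i)) + w • fun i => Complex.ofRealHom (a i))) ?_ ?_
    · intro i
      simpa using hc i
    · rw [replicate_smul_append]
      exact mul_eq_zero_of_right _ hw
  -- A rotation by `c = ∓I` rules out roots with positive or negative imaginary part.
  have him : w.im = 0 := by
    obtain ⟨i, hi⟩ := key (-Complex.I)
    obtain ⟨j, hj⟩ := key Complex.I
    simp at hi hj
    have := ha i
    have := ha j
    nlinarith
  refine ⟨him, ?_⟩
  obtain ⟨i, hi⟩ := key 1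
  simp at hi
  have := hy i
  have := ha i
  by_contra! hc
  nlinarith

lemma splits_linePoly (l : List (ι → ℝ)) (hl : ∀ v ∈ l, ∀ i, 0 < v i) (m : ℕ) (S : Finset ι)
    (hS : m + l.length = S.card) {y a : ι → ℝ} (hy : ∀ i, 0 < y i) (ha : ∀ i, 0 < a i) :
    (linePoly m y a l S).Splits := by
  refine Splits.of_splits_map Complex.ofRealHom (IsAlgClosed.splits _) fun w hw => ?_
  have := (root_linePoly_neg l hl m S hS hy ha (isRoot_of_mem_roots hw)).1
  exact ⟨w.re, Complex.ext (by simp) (by simp [this])⟩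

end mixedPermanent

/-! ### Polynomials with real negative roots -/

/-- The inequality of arithmetic and geometric means, without roots. -/
lemma Multiset.prod_le_sum_div_card_pow (s : Multiset ℝ) (hs : ∀ x ∈ s, 0 < x) :
    s.prod ≤ (s.sum / s.card) ^ s.card := by
  rcases s.empty_or_exists_mem with rfl | ⟨x₀, hx₀⟩
  · simp
  have hcard : 0 < s.card := Multiset.card_pos_iff_exists_mem.mpr ⟨x₀, hx₀⟩
  have hsum : 0 < s.sum := by
    obtain ⟨t, rfl⟩ := Multiset.exists_cons_of_mem hx₀
    rw [Multiset.sum_cons]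
    exact add_pos_of_pos_of_nonneg (hs _ hx₀)
      (Multiset.sum_nonneg fun x hx => (hs x (Multiset.mem_cons_of_mem hx)).le)
  set G := s.sum / s.card with hG
  have hc : (0 : ℝ) < s.card := by exact_mod_cast hcard
  have hGpos : 0 < G := div_pos hsum hc
  -- Each factor satisfies `x ≤ G * exp (x / G - 1)`, and the exponents add up to `0`.
  calc s.prod = (s.map fun x => x).prod := by simp
    _ ≤ (s.map fun x => G * Real.exp (x / G - 1)).prod := by
        refine Multiset.prod_map_le_prod_map₀ _ _ (fun x hx => (hs x hx).le) fun x _ => ?_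
        have := Real.add_one_le_exp (x / G - 1)
        rw [sub_add_cancel, div_le_iff₀ hGpos] at this
        linarith
    _ = G ^ s.card * Real.exp ((s.map fun x => x / G - 1).sum) := by
        rw [Multiset.prod_map_mul, Multiset.map_const', Multiset.prod_replicate,
          Real.exp_multiset_sum, Multiset.map_map]
        rfl
    _ = G ^ s.card := by
        rw [Multiset.sum_map_sub, Multiset.sum_map_div, Multiset.map_id', Multiset.map_const',
          Multiset.sum_replicate, hG]
        have : s.sum / (s.sum / s.card) - s.card • (1 : ℝ) = 0 := by
          field_simp
          simp
        rw [this, Real.exp_zero, mul_one]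

open Polynomial in
/-- A polynomial with real negative roots grows at most like the `natDegree`-th power of the affine
function with the same normalised value and derivative at `0`. -/
lemma Polynomial.Splits.eval_le_of_roots_neg {p : ℝ[X]} (hp : p.Splits)
    (hroots : ∀ x ∈ p.roots, x < 0) (h0 : 0 < p.eval 0) {t : ℝ} (ht : 0 < t) :
    p.eval t ≤ p.eval 0 *
      (1 + t * (p.derivative.eval 0 / p.eval 0) / p.natDegree) ^ p.natDegree := by
  rw [hp.eval_derivative_div_eval_of_ne_zero h0.ne', hp.natDegree_eq_card_roots]
  rcases Multiset.empty_or_exists_mem p.roots with hr | ⟨x₀, hx₀⟩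
  · rw [hp.eval_eq_prod_roots t, hp.eval_eq_prod_roots 0]
    simp [hr]
  have hc : (p.roots.card : ℝ) ≠ 0 := by
    exact_mod_cast (Multiset.card_pos_iff_exists_mem.mpr ⟨x₀, hx₀⟩).ne'
  have hprod : p.eval t = p.eval 0 * (p.roots.map fun x => 1 + t * (1 / (0 - x))).prod := by
    rw [hp.eval_eq_prod_roots t, hp.eval_eq_prod_roots 0, mul_assoc, ← Multiset.prod_map_mul]
    congr 2
    refine Multiset.map_congr rfl fun x hx => ?_
    have := (hroots x hx).ne
    field_simp
    ring
  rw [hprod]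
  refine mul_le_mul_of_nonneg_left ?_ h0.le
  refine (Multiset.prod_le_sum_div_card_pow _ ?_).trans_eq ?_
  · intro y hy
    obtain ⟨x, hx, rfl⟩ := Multiset.mem_map.mp hy
    have : 0 < 1 / (0 - x) := one_div_pos.mpr (by linarith [hroots x hx])
    positivity
  · rw [Multiset.card_map, Multiset.sum_map_add, Multiset.map_const', Multiset.sum_replicate,
      Multiset.sum_map_mul_left, add_div]
    simp [hc]

/-! ### The capacity bound and van der Waerden's inequality -/

namespace mixedPermanent

open Polynomial

variable {ι : Type*} [DecidableEq ι]

/-- One step of the capacity argument: a lower bound that is linear in the coefficient of `a`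
yields a lower bound for the derivative in the direction `a`. -/
lemma capacity_step (l : List (ι → ℝ)) (hl : ∀ v ∈ l, ∀ i, 0 < v i) {m : ℕ} (hm : 0 < m)
    (S : Finset ι) (hS : m + 1 + l.length = S.card) {y a : ι → ℝ} (hy : ∀ i, 0 < y i)
    (ha : ∀ i, 0 < a i) {γ : ℝ}
    (h : ∀ t : ℝ, 0 < t → γ * (m + 1) ^ (m + 1) * t
      ≤ mixedPermanent (List.replicate (m + 1) (y + t • a) ++ l) S) :
    γ * m ^ m ≤ mixedPermanent (List.replicate m y ++ a :: l) S := by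
  have hpos : ∀ (k j : ℕ) (u v : ι → ℝ), (∀ i, 0 < u i) → (∀ i, 0 < v i) → k + j = m + 1 →
      0 < mixedPermanent (List.replicate k u ++ (List.replicate j v ++ l)) S := by
    intro k j u v hu hv hkj
    refine pos _ S ?_ (by simp; omega)
    simp only [List.mem_append, List.mem_replicate]
    rintro w (⟨-, rfl⟩ | ⟨-, rfl⟩ | hw)
    exacts [hu, hv, hl w hw]
  set r₀ := mixedPermanent (List.replicate (m + 1) y ++ l) S with hr₀
  set r₁ := mixedPermanent (List.replicate m y ++ a :: l) S with hr₁
  have h₀ : 0 < r₀ := hpos (m + 1) 0 y a hy ha (by omega)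
  have h₁ : 0 < r₁ := hpos m 1 y a hy ha (by omega)
  set p := linePoly (m + 1) y a l S with hp
  have hp0 : p.eval 0 = r₀ := by rw [hp, eval_linePoly, zero_smul, add_zero]
  have hp1 : p.derivative.eval 0 = (m + 1) * r₁ := by
    rw [hp, derivative_linePoly, eval_mul, eval_linePoly, zero_smul, add_zero, ← hr₁]
    simp
  have hdeg : p.natDegree = m + 1 := by
    refine le_antisymm (natDegree_linePoly_le _ _ _ _ _) (le_natDegree_of_ne_zero ?_)
    rw [hp, coeff_linePoly]
    exact (hpos (m + 1) 0 a a ha ha (by omega)).ne'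
  have hneg : ∀ x ∈ p.roots, x < 0 := by
    intro x hx
    have hx0 : (p.map Complex.ofRealHom).eval (x : ℂ) = 0 := by
      rw [← Complex.ofRealHom_eq_coe, eval_map_apply, (isRoot_of_mem_roots hx).eq_zero, map_zero]
    simpa using (root_linePoly_neg l hl (m + 1) S hS hy ha hx0).2
  have hm' : (0 : ℝ) < m := by exact_mod_cast hm
  -- The upper bound for `p.eval t / t` is smallest at this value of `t`.
  have ht : 0 < r₀ / (m * r₁) := by positivity
  have h2 := (splits_linePoly l hl (m + 1) S hS hy ha).eval_le_of_roots_neg hneg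
    (hp0 ▸ h₀) ht
  rw [← hp, hp0, hp1, hdeg] at h2
  have h3 := (h _ ht).trans ((eval_linePoly (m + 1) y a l S _).symm.trans_le h2)
  have e : 1 + r₀ / (m * r₁) * ((m + 1) * r₁ / r₀) / ((m + 1 : ℕ) : ℝ) = (m + 1) / m := by
    push_cast
    field_simp
  rw [e, div_pow, mul_div_assoc', mul_div_assoc', div_le_div_iff₀ (by positivity) (by positivity)]
    at h3
  have hc : (0 : ℝ) < r₀ * (m + 1) ^ (m + 1) * m := by positivity
  refine le_of_mul_le_mul_left ?_ hc
  calc _ = γ * (m + 1) ^ (m + 1) * r₀ * m ^ (m + 1) := by ring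
    _ ≤ _ := h3
    _ = _ := by ring

/-- Removing the variables one at a time turns a capacity bound for a product of positive linear
forms into a bound for all of the intermediate mixed permanents. -/
lemma capacity_induction {n : ℕ} (S : Finset ι) (hS : S.card = n) (a : ℕ → ι → ℝ)
    (ha : ∀ j i, 0 < a j i) {C : ℝ}
    (h : ∀ x : ℕ → ℝ, (∀ j, 0 < x j) →
      C * ∏ j ∈ Finset.range n, x j ≤ ∏ i ∈ S, (∑ j ∈ Finset.range n, x j • a j) i)
    (k m : ℕ) (hkm : m + 1 + k = n) (x : ℕ → ℝ) (hx : ∀ j, 0 < x j) :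
    C * (n.factorial / n ^ n) * (∏ j ∈ Finset.range (m + 1), x j) * (m + 1) ^ (m + 1)
      ≤ mixedPermanent (List.replicate (m + 1) (∑ j ∈ Finset.range (m + 1), x j • a j)
          ++ (List.range' (m + 1) k).map a) S := by
  induction k generalizing m x with
  | zero =>
    obtain rfl : m + 1 = n := hkm
    have hm : ((m : ℝ) + 1) ^ (m + 1) ≠ 0 := by positivity
    rw [List.range'_zero, List.map_nil, List.append_nil, replicate_card _ _ _ hS]
    refine le_trans (le_of_eq ?_) (mul_le_mul_of_nonneg_left (h x hx) (Nat.cast_nonneg _))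
    push_cast
    field_simp
  | succ k ih =>
    rw [List.range'_succ, List.map_cons]
    have hy : ∀ i, 0 < (∑ j ∈ Finset.range (m + 1), x j • a j) i := by
      intro i
      rw [Finset.sum_apply]
      exact Finset.sum_pos (fun j _ => mul_pos (hx j) (ha j i)) (by simp)
    have hl : ∀ v ∈ (List.range' (m + 1 + 1) k).map a, ∀ i, 0 < v i := by
      intro v hv
      obtain ⟨j, -, rfl⟩ := List.mem_map.mp hv
      exact ha j
    have := capacity_step _ hl (m := m + 1) m.succ_pos S (by simp; omega) hy (ha (m + 1))
      (γ := C * (n.factorial / n ^ n) * (∏ j ∈ Finset.range (m + 1), x j)) ?_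
    · exact_mod_cast this
    intro t ht
    have h1 := ih (m + 1) (by omega) (Function.update x (m + 1) t) (fun j => by
      rcases eq_or_ne j (m + 1) with rfl | hj
      · simpa using ht
      · simpa [hj] using hx j)
    have hne : ∀ j ∈ Finset.range (m + 1), j ≠ m + 1 := fun j hj =>
      (Finset.mem_range.mp hj).ne
    rw [Finset.prod_range_succ, Finset.sum_range_succ, Function.update_self,
      Finset.prod_congr rfl fun j hj => Function.update_of_ne (hne j hj) t x,
      Finset.sum_congr rfl fun j hj => by rw [Function.update_of_ne (hne j hj) t x]] at h1
    refine le_trans (le_of_eq ?_) h1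
    push_cast
    ring

end mixedPermanent

namespace Matrix

variable {n : ℕ}

/-- Gurvits' capacity inequality for a matrix with positive entries; `C` is any lower bound for the
capacity, the infimum of `(∏ i, (M *ᵥ x) i) / ∏ j, x j` over positive `x`. -/
theorem capacity_le_permanent (M : Matrix (Fin n) (Fin n) ℝ) (hM : ∀ i j, 0 < M i j) {C : ℝ}
    (h : ∀ x : Fin n → ℝ, (∀ j, 0 < x j) → C * ∏ j, x j ≤ ∏ i, (M *ᵥ x) i) :
    C * (n.factorial / n ^ n) ≤ M.permanent := by
  rcases n with - | n
  · simpa [permanent_isEmpty] using h 1 (by simp)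
  -- The columns of `M`, with positive junk values beyond the last one.
  let a : ℕ → Fin (n + 1) → ℝ := fun j i => if hj : j < n + 1 then M i ⟨j, hj⟩ else 1
  have haM : ∀ j : Fin (n + 1), a j = fun i => M i j := fun j => by
    funext i
    simp only [a, dif_pos j.isLt]
  have ha : ∀ j i, 0 < a j i := by
    intro j i
    simp only [a]
    split_ifs
    exacts [hM _ _, one_pos]
  have key := mixedPermanent.capacity_induction Finset.univ (Finset.card_fin (n + 1)) a ha
    (C := C) ?_ n 0 (by omega) (fun _ => 1) (by simp)
  · rw [← mixedPermanent.ofFn_univ]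
    have e : (List.ofFn fun j i => M i j) = (List.range' 0 (n + 1)).map a := by
      rw [← List.range_eq_range', ← List.map_coe_finRange_eq_range,
        List.map_map, List.ofFn_eq_map]
      exact List.map_congr_left fun j _ => (haM j).symm
    rw [e, List.range'_succ]
    simpa using key
  · intro x hx
    have := h (fun j => x j) (fun j => hx j)
    rw [Finset.prod_range]
    refine this.trans_eq (Finset.prod_congr rfl fun i _ => ?_)
    rw [Finset.sum_range, Finset.sum_apply, Matrix.mulVec, dotProduct]
    refine Finset.sum_congr rfl fun j _ => ?_
    rw [haM j, Pi.smul_apply, smul_eq_mul, mul_comm]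

/-- The capacity of a doubly stochastic matrix is at least `1`, by the weighted inequality of
arithmetic and geometric means in each row. -/
lemma prod_le_prod_mulVec_of_mem_doublyStochastic {M : Matrix (Fin n) (Fin n) ℝ}
    (hM : M ∈ doublyStochastic ℝ (Fin n)) (x : Fin n → ℝ) (hx : ∀ j, 0 < x j) :
    ∏ j, x j ≤ ∏ i, (M *ᵥ x) i := by
  calc ∏ j, x j = ∏ j, ∏ i, x j ^ M i j := by
        refine Finset.prod_congr rfl fun j _ => ?_
        rw [← Real.rpow_sum_of_pos (hx j), sum_col_of_mem_doublyStochastic hM, Real.rpow_one]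
    _ = ∏ i, ∏ j, x j ^ M i j := Finset.prod_comm
    _ ≤ ∏ i, (M *ᵥ x) i := by
        refine Finset.prod_le_prod (fun i _ => Finset.prod_nonneg fun j _ =>
          Real.rpow_nonneg (hx j).le _) fun i _ => ?_
        exact Real.geom_mean_le_arith_mean_weighted _ _ _
          (fun j _ => nonneg_of_mem_doublyStochastic hM) (sum_row_of_mem_doublyStochastic hM i)
          fun j _ => (hx j).le

/-- Van der Waerden's inequality: the permanent of a doubly stochastic matrix is at least that of
the matrix with all entries `1 / n`. -/
theorem vanDerWaerden {M : Matrix (Fin n) (Fin n) ℝ} (hM : M ∈ doublyStochastic ℝ (Fin n)) :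
    (n.factorial / n ^ n : ℝ) ≤ M.permanent := by
  rcases n.eq_zero_or_pos with rfl | hn
  · simp [permanent_isEmpty]
  have hn' : (n : ℝ) ≠ 0 := by exact_mod_cast hn.ne'
  let J : Matrix (Fin n) (Fin n) ℝ := fun _ _ => (n : ℝ)⁻¹
  have hJ : J ∈ doublyStochastic ℝ (Fin n) := by
    rw [mem_doublyStochastic_iff_sum]
    simp [J, hn']
  -- The segment from `M` to the matrix `J` consists, up to `M`, of positive matrices.
  let N : ℝ → Matrix (Fin n) (Fin n) ℝ := fun t => (1 - t) • M + t • J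
  have hcont : Continuous fun t => (N t).permanent := by
    simp only [permanent, N, add_apply, smul_apply, smul_eq_mul]
    fun_prop
  have hlim : Filter.Tendsto (fun t => (N t).permanent) (nhdsWithin 0 (Set.Ioi 0))
      (nhds M.permanent) := by
    have := hcont.tendsto 0
    simp only [N, sub_zero, one_smul, zero_smul, add_zero] at this
    exact this.mono_left nhdsWithin_le_nhds
  refine ge_of_tendsto hlim ?_
  filter_upwards [Ioo_mem_nhdsGT (zero_lt_one' ℝ)] with t ht
  have hN : N t ∈ doublyStochastic ℝ (Fin n) :=
    convex_doublyStochastic hM hJ (by linarith [ht.2]) ht.1.le (by ring)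
  have hpos : ∀ i j, 0 < N t i j := fun i j => by
    have h1 : 0 ≤ (1 - t) * M i j :=
      mul_nonneg (by linarith [ht.2]) (nonneg_of_mem_doublyStochastic hM)
    have h2 : 0 < t * (n : ℝ)⁻¹ := mul_pos ht.1 (by positivity)
    exact add_pos_of_nonneg_of_pos h1 h2
  have := capacity_le_permanent (N t) hpos (C := 1) fun x hx => by
    simpa using prod_le_prod_mulVec_of_mem_doublyStochastic hN x hx
  simpa using this

end Matrix

/-! ### Scaling the band matrix -/

/-- The exponent of the scaling factor of row and column `j` of the band matrix
`|i - j| ≤ r` of size `r + 1 + p`: the number of zeros in that row. At most one of the two truncated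
subtractions is nonzero when `p ≤ r`. -/
def bandExponent (r p j : ℕ) : ℕ := (p - j) + (j - r)

section Band

variable {m p : ℕ} {α : ℝ}

lemma sum_bandExponent (r p : ℕ) :
    ∑ j ∈ Finset.range (r + 1 + p), bandExponent r p j = p * (p + 1) := by
  have h1 : ∀ q, 2 * ∑ j ∈ Finset.range (r + 1 + q), (j - r) = q * (q + 1) := by
    intro q
    induction q with
    | zero =>
      simp only [add_zero, zero_mul, mul_eq_zero, OfNat.ofNat_ne_zero, false_or]
      exact Finset.sum_eq_zero fun j hj => by
        have := Finset.mem_range.mp hj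
        omega
    | succ q ih =>
      rw [← add_assoc, Finset.sum_range_succ, mul_add, ih,
        show r + 1 + q - r = q + 1 by omega]
      ring
  have h2 : ∑ j ∈ Finset.range (r + 1 + p), (p - j)
      = ∑ j ∈ Finset.range (r + 1 + p), (j - r) := by
    rw [← Finset.sum_range_reflect]
    refine Finset.sum_congr rfl fun j hj => ?_
    have := Finset.mem_range.mp hj
    omega
  simp only [bandExponent, Finset.sum_add_distrib]
  rw [h2, ← h1 p, two_mul]

/-- The prefix sum of the scaling factors over the first columns, where the exponents decrease. -/
lemma sum_scale_of_le {N : ℕ} (hN : N ≤ p) :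
    (∑ j ∈ Finset.range N, α ^ bandExponent (p + 1 + m) p j) * (α - 1)
      = α ^ (p + 1) - α ^ (p + 1 - N) := by
  induction N with
  | zero => simp
  | succ N ih =>
    rw [Finset.sum_range_succ, add_mul, ih (by omega),
      show bandExponent (p + 1 + m) p N = p - N by unfold bandExponent; omega,
      show p + 1 - N = p - N + 1 by omega, show p + 1 - (N + 1) = p - N by omega]
    ring

/-- The prefix sum of the scaling factors up to a column in the part of the matrix without zeros,
where the exponents vanish. -/
lemma sum_scale_middle {s : ℕ} (hs : s ≤ m + 2) :
    (∑ j ∈ Finset.range (p + s), α ^ bandExponent (p + 1 + m) p j) * (α - 1)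
      = α ^ (p + 1) - α + s * (α - 1) := by
  induction s with
  | zero => simpa using sum_scale_of_le (α := α) (m := m) le_rfl
  | succ s ih =>
    rw [← add_assoc, Finset.sum_range_succ, add_mul, ih (by omega),
      show bandExponent (p + 1 + m) p (p + s) = 0 by unfold bandExponent; omega]
    push_cast
    ring

/-- The prefix sum of the scaling factors including columns where the exponents increase. The
equation satisfied by `α` makes it a power of `α`. -/
lemma sum_scale_right (hα : α ^ (p + 1) + m * α = m + 2) (s : ℕ) :
    (∑ j ∈ Finset.range (p + 1 + m + 1 + s), α ^ bandExponent (p + 1 + m) p j) * (α - 1)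
      = α ^ (s + 1) := by
  induction s with
  | zero =>
    have := sum_scale_middle (α := α) (p := p) (le_refl (m + 2))
    rw [show p + (m + 2) = p + 1 + m + 1 + 0 by ring] at this
    rw [this]
    push_cast
    linear_combination hα
  | succ s ih =>
    rw [← add_assoc, Finset.sum_range_succ, add_mul, ih,
      show bandExponent (p + 1 + m) p (p + 1 + m + 1 + s) = s + 1 by unfold bandExponent; omega]
    ring

/-- With the scaling factors `α ^ bandExponent`, all scaled row sums of the band matrix agree. -/
lemma sum_scale_row (hα : α ^ (p + 1) + m * α = m + 2) {i : ℕ} (hi : i < p + 1 + m + 1 + p) :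
    (∑ j ∈ Finset.range (p + 1 + m + 1 + p),
      if i ≤ j + (p + 1 + m) ∧ j ≤ i + (p + 1 + m) then α ^ bandExponent (p + 1 + m) p j else 0)
      * (α - 1) * α ^ bandExponent (p + 1 + m) p i = α ^ (p + 1) := by
  set r := p + 1 + m with hr
  have hfilter : (Finset.range (r + 1 + p)).filter (fun j => i ≤ j + r ∧ j ≤ i + r)
      = Finset.Ico (i - r) (min (r + 1 + p) (i + r + 1)) := by
    ext j
    simp only [Finset.mem_filter, Finset.mem_range, Finset.mem_Ico]
    omega
  rw [← Finset.sum_filter, hfilter, Finset.sum_Ico_eq_sub _ (by omega), sub_mul]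
  rcases le_or_gt i p with h1 | h1
  · rw [show min (r + 1 + p) (i + r + 1) = r + 1 + i by omega, show i - r = 0 by omega,
      sum_scale_right hα, show bandExponent r p i = p - i by unfold bandExponent; omega]
    simp only [Finset.range_zero, Finset.sum_empty, zero_mul, sub_zero]
    rw [← pow_add]
    congr 1
    omega
  rw [show min (r + 1 + p) (i + r + 1) = r + 1 + p by omega, sum_scale_right hα,
    sum_scale_of_le (by omega), sub_sub_cancel, ← pow_add]
  congr 1
  unfold bandExponent
  omega

end Band

/-! ### The size of the ball -/

lemma mem_permBall_iff {r n : ℕ} {f g : Equiv.Perm (Fin n)} :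
    g ∈ permBall r n f ↔ ∀ i, (f i : ℕ) ≤ g i + r ∧ (g i : ℕ) ≤ f i + r := by
  simp only [permBall, permInfDist, Finset.mem_filter, Finset.mem_univ, true_and, Finset.sup_le_iff,
    forall_true_left]
  refine forall_congr' fun i => ?_
  omega

/-- Van der Waerden's inequality for the scaled band matrix. -/
lemma factorial_div_pow_le_card_permBall {m p r n : ℕ} (hr : r = p + 1 + m) (hn : n = r + 1 + p)
    {α : ℝ} (hα₁ : 1 < α) (hα : α ^ (p + 1) + m * α = m + 2) (f : Equiv.Perm (Fin n)) :
    (n.factorial / n ^ n : ℝ)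
      ≤ ((α - 1) / α ^ (p + 1)) ^ n * α ^ (2 * (p * (p + 1))) * (permBall r n f).card := by
  have hα₀ : 0 < α := one_pos.trans hα₁
  set c : ℝ := (α - 1) / α ^ (p + 1) with hc
  have hc₀ : 0 ≤ c := div_nonneg (by linarith) (by positivity)
  let u : Fin n → ℕ := fun j => bandExponent r p j
  let B : Fin n → Fin n → ℝ := fun i j =>
    if (i : ℕ) ≤ j + r ∧ (j : ℕ) ≤ i + r then c * (α ^ u i * α ^ u j) else 0
  have hsymm : ∀ i j, B i j = B j i := fun i j => by
    simp only [B, and_comm, mul_comm (α ^ u i)]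
  have hrow : ∀ i, ∑ j, B i j = 1 := by
    intro i
    have h := sum_scale_row hα (i := i) (by omega)
    rw [← hr, ← hn, Finset.sum_range] at h
    have e : ∀ j : Fin n, B i j = c * α ^ u i *
        (if (i : ℕ) ≤ j + r ∧ (j : ℕ) ≤ i + r then α ^ bandExponent r p j else 0) := fun j => by
      simp only [B, u, mul_ite, mul_zero, mul_assoc]
    rw [Finset.sum_congr rfl fun j _ => e j, ← Finset.mul_sum, hc, div_mul_eq_mul_div,
      div_mul_eq_mul_div, div_eq_one_iff_eq (by positivity), ← h]
    ring
  -- Permuting one index of the matrix by `f` centres the ball at `f`.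
  let M : Matrix (Fin n) (Fin n) ℝ := fun b i => B (f i) b
  have hM : M ∈ doublyStochastic ℝ (Fin n) := by
    rw [mem_doublyStochastic_iff_sum]
    refine ⟨fun b i => ?_, fun b => ?_, fun i => hrow (f i)⟩
    · simp only [M, B]
      split_ifs
      · positivity
      · exact le_rfl
    · simp only [M, hsymm _ b]
      rw [Equiv.sum_comp f (B b), hrow]
  have hu : ∀ σ : Equiv.Perm (Fin n), ∏ i, α ^ u (σ i) = α ^ (p * (p + 1)) := by
    intro σ
    rw [Equiv.prod_comp σ (fun i => α ^ u i), Finset.prod_pow_eq_pow_sum,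
      ← Finset.sum_range (bandExponent r p), hn, sum_bandExponent]
  refine (Matrix.vanDerWaerden hM).trans_eq ?_
  have hterm : ∀ σ : Equiv.Perm (Fin n), ∏ i, M (σ i) i
      = if σ ∈ permBall r n f then c ^ n * α ^ (2 * (p * (p + 1))) else 0 := by
    intro σ
    split_ifs with h
    · rw [mem_permBall_iff] at h
      rw [Finset.prod_congr rfl fun i _ => if_pos (h i), Finset.prod_mul_distrib,
        Finset.prod_mul_distrib, hu f, hu σ, ← pow_add, ← two_mul]
      simp
    · rw [mem_permBall_iff, not_forall] at h
      obtain ⟨i, hi⟩ := h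
      exact Finset.prod_eq_zero (Finset.mem_univ i) (if_neg hi)
  rw [Matrix.permanent, Finset.sum_congr rfl fun σ _ => hterm σ, ← Finset.sum_filter,
    Finset.sum_const, Finset.filter_mem_eq_inter, Finset.univ_inter, nsmul_eq_mul, mul_comm]

lemma isAlpha_iff {m p : ℕ} {α : ℝ} :
    IsAlpha (p + 1 + m) (p + 1 + m + 1 + p) α ↔ 0 < α ∧ α ^ (p + 1) + m * α = m + 2 := by
  rw [IsAlpha, show p + 1 + m + 1 + p - (p + 1 + m) = p + 1 by omega]
  push_cast
  refine and_congr_right fun _ => ⟨fun h => ?_, fun h => ?_⟩ <;> linear_combination h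

lemma one_lt_of_pow_add_mul_eq {m p : ℕ} {α : ℝ} (h₀ : 0 < α) (h : α ^ (p + 1) + m * α = m + 2) :
    1 < α := by
  by_contra! hle
  have h1 : α ^ (p + 1) ≤ 1 := pow_le_one₀ h₀.le hle
  have h2 : (m : ℝ) * α ≤ m := mul_le_of_le_one_right m.cast_nonneg hle
  linarith

lemma existsUnique_isAlpha (m p : ℕ) (hp : 1 ≤ p) :
    ∃! α : ℝ, IsAlpha (p + 1 + m) (p + 1 + m + 1 + p) α := by
  simp only [isAlpha_iff]
  have hmono : StrictMonoOn (fun x : ℝ => x ^ (p + 1) + m * x) (Set.Ici 0) :=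
    (pow_left_strictMonoOn₀ p.succ_ne_zero).add_monotone
      ((monotone_mul_left_of_nonneg m.cast_nonneg).monotoneOn _)
  have hcont : ContinuousOn (fun x : ℝ => x ^ (p + 1) + m * x) (Set.Icc 1 2) := by fun_prop
  have h4 : (2 : ℝ) ^ 2 ≤ 2 ^ (p + 1) := pow_le_pow_right₀ one_le_two (by omega)
  have hm : (0 : ℝ) ≤ m := m.cast_nonneg
  obtain ⟨x, hx, hxe⟩ := intermediate_value_Icc (one_le_two (α := ℝ)) hcont
    (show (m : ℝ) + 2 ∈ Set.Icc _ _ from ⟨by norm_num; linarith, by linarith⟩)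
  have hx₀ : 0 < x := one_pos.trans_le hx.1
  refine ⟨x, ⟨hx₀, hxe⟩, fun y hy => ?_⟩
  exact hmono.injOn hy.1.le hx₀.le (hy.2.trans hxe.symm)

theorem mainTheorem4 (n r : ℕ) (hr₁ : ((n : ℝ) - 1) / 2 < (r : ℝ))
    (hr₂ : (r : ℝ) < (n : ℝ) - 1) :
    (∃! α : ℝ, IsAlpha r n α) ∧
      ∀ α : ℝ, IsAlpha r n α → ∀ f : Equiv.Perm (Fin n),
        Real.logb 2 ((permBall r n f).card : ℝ) ≥
          Real.logb 2 (n.factorial : ℝ) - (n : ℝ) * Real.logb 2 (n : ℝ)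
            - (n : ℝ) * Real.logb 2 (α - 1)
            + ((n : ℝ) - (r : ℝ)) * (2 * (r : ℝ) - (n : ℝ) + 2) * Real.logb 2 α := by
  have h₁ : n < 2 * r + 1 := by
    have : (n : ℝ) < ((2 * r + 1 : ℕ) : ℝ) := by push_cast; linarith
    exact_mod_cast this
  have h₂ : r + 1 < n := by
    have : ((r + 1 : ℕ) : ℝ) < n := by push_cast; linarith
    exact_mod_cast this
  -- Here `p + 1 = n - r` and `m = 2 * r - n`.
  obtain ⟨p, rfl⟩ : ∃ p, n = r + 1 + p := Nat.exists_eq_add_of_le h₂.le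
  obtain ⟨m, rfl⟩ : ∃ m, r = p + 1 + m := Nat.exists_eq_add_of_le (by omega)
  refine ⟨existsUnique_isAlpha m p (by omega), fun α hα f => ?_⟩
  rw [isAlpha_iff] at hα
  have hα₁ := one_lt_of_pow_add_mul_eq hα.1 hα.2
  have key := factorial_div_pow_le_card_permBall rfl rfl hα₁ hα.2 f
  have hcard : (0 : ℝ) < (permBall (p + 1 + m) (p + 1 + m + 1 + p) f).card := by
    exact_mod_cast Finset.card_pos.mpr ⟨f, mem_permBall_iff.mpr fun i => by omega⟩
  have hα₀ : α ≠ 0 := hα.1.ne'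
  have hα₂ : α - 1 ≠ 0 := (sub_pos.mpr hα₁).ne'
  have hfac : ((p + 1 + m + 1 + p).factorial : ℝ) ≠ 0 := by
    exact_mod_cast Nat.factorial_ne_zero _
  have hn : (((p + 1 + m + 1 + p : ℕ) : ℝ)) ≠ 0 := by
    exact_mod_cast (by omega : p + 1 + m + 1 + p ≠ 0)
  have hlog := Real.logb_le_logb_of_le one_lt_two (by positivity) key
  rw [Real.logb_div hfac (pow_ne_zero _ hn), Real.logb_mul (by positivity) hcard.ne',
    Real.logb_mul (by positivity) (by positivity), Real.logb_pow, Real.logb_pow, Real.logb_pow,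
    Real.logb_div hα₂ (by positivity), Real.logb_pow] at hlog
  push_cast at hlog ⊢
  linarith
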